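/- Setting. For each security parameter $n$ let $\mathsf{Gen}(1^n)$ output a pair (index $k\in K_n$, trapdoor $t_k$), and let $\{f_k:D\to R\}_{k\in K_n}$ be functions between sets of bit strings ($D=D_n$ finite and non-empty) that are two-regular: every $y\in\operatorname{Im} f_k$ has exactly two preimages. (In the application the family is also trapdoor, one-way and collision resistant against quantum adversaries; this is not needed here.) For $x\in D$ let $x'\neq x$ be the unique other element of $D$ with $f_k(x')=f_k(x)$. Let $E=E_n$ be a finite non-empty set of bit strings and $g_k:D\times D\times E\to\{0,1\}^3$ functions, whose values are also read as numbers $0,\dots,7$. Put $|+_\theta\rangle=\frac1{\sqrt2}(|0\rangle+e^{i\theta}|1\rangle)$. A QPT algorithm is a quantum algorithm that gets $1^n$ with its input and runs in time polynomial in $n$. Ideal QFactory. Sample $(k,t_k)\leftarrow\mathsf{Gen}(1^n)$, and $x\leftarrow D$, $\beta\leftarrow E$ uniformly; let $y=f_k(x)$. If the last bits of $x$ and $x'$ are equal, return abort to both parties. Otherwise put $\theta=\frac\pi4\, g_k(x,x',\beta)$ and return $(t_k,y,\beta,\theta)$ to the client and $(k,y,\beta,|+_\theta\rangle)$ to the server.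 Let $p(n)$ be the probability of abort. SRQG $\mathcal F(M,p)$. With probability $p$ return abort to both parties. Otherwise sample $(m_C,m_S)\leftarrow M$ and $r\leftarrow\{0,\dots,7\}$ uniformly, and return $(m_C,r)$ to the client and $(m_S,|+_{r\pi/4}\rangle)$ to the server. A protocol is a PSRQG with distribution $M$ and abort probability $p$ if every QPT algorithm, given what the server receives (classical messages and qubit, or abort), distinguishes the protocol from $\mathcal F(M,p)$ with advantage negligible in $n$. $M_{QF}$ is the distribution of $((t_k,y,\beta),(k,y,\beta))$ where $(k,t_k)\leftarrow\mathsf{Gen}(1^n)$, $y$ is uniform among the elements of $R$ with two preimages under $f_k$, and $\beta$ is uniform in $E$. $M_{QF}^{\ast}$ is $M_{QF}$ conditioned on the two preimages of $y$ having different last bits (for $n$ with $p(n)=1$ its value is irrelevant). Hard-core. For a set $S$ of pairs $(x,x')$ with $x\ne x'$, $f_k(x)=f_k(x')$, the function $g_k(x,x',\beta)$ restricted to $S$ is a hard-core function for $f_k$ if (a) a QPT algorithm given $(k,x,x',\beta)$ computes $g_k(x,x',\beta)$ with probability at least $2/3$ for all $k\in K_n$, $(x,x')\in S$ and $\beta\in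 E$, and (b) for every QPT algorithm $\mathcal A$, $$\big|\Pr[\mathcal A(k,f_k(x),\beta,g_k(x,x',\beta))=1]-\Pr[\mathcal A(k,f_k(x),\beta,r)=1]\big|$$ is negligible in $n$, where $(k,t_k)\leftarrow\mathsf{Gen}(1^n)$, $x\leftarrow D$, $\beta\leftarrow E$ are conditioned on $(x,x')\in S$ (both probabilities are taken as $0$ if the condition has probability $0$) and $r\leftarrow\{0,1\}^3$ is uniform. Lemma. (1) If $p(n)$ is negligible (for instance, if the last bits of $x$ and $x'$ always differ) and $g_k(x,x',\beta)$, restricted to all pairs $x\ne x'$ with $f_k(x)=f_k(x')$, is a hard-core function for $f_k$, then the Ideal QFactory protocol is a PSRQG with distribution $M_{QF}$ and abort probability $p$. (2) With no assumption on $p(n)$: if $g_k(x,x',\beta)$, restricted to the pairs $x\neq x'$ with $f_k(x)=f_k(x')$ whose last bits differ, is a hard-core function for $f_k$, then the Ideal QFactory protocol is a PSRQG with distribution $M_{QF}^{\ast}$ and abort probability $p$. -/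

import Mathlib

open scoped ENNReal

noncomputable section

namespace QFactory

/-! ### Quantum states on a register of qubits -/

/-- A (possibly unnormalised) pure state of qubits numbered by `ℕ`, all but finitely many of which
are `|0⟩` in every basis state: the computational basis state in which exactly the qubits of
`s : Finset ℕ` are `|1⟩` has amplitude `ψ s`. -/
abbrev QState : Type := Finset ℕ → ℂ

/-- The squared norm of a state. -/
def normSq (ψ : QState) : ℝ≥0∞ := ∑' s, ‖ψ s‖ₑ ^ 2

/-- Hadamard gate on qubit `i`: `|0⟩ ↦ (|0⟩ + |1⟩)/√2`, `|1⟩ ↦ (|0⟩ - |1⟩)/√2`. -/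
def gateH (i : ℕ) (ψ : QState) : QState := fun s =>
  if i ∈ s then (ψ (s.erase i) - ψ s) / (Real.sqrt 2 : ℂ)
  else (ψ s + ψ (insert i s)) / (Real.sqrt 2 : ℂ)

/-- `T` gate on qubit `i`: `|1⟩ ↦ e^{iπ/4}|1⟩`. -/
def gateT (i : ℕ) (ψ : QState) : QState := fun s =>
  if i ∈ s then Complex.exp (Complex.I * (Real.pi / 4 : ℝ)) * ψ s else ψ s

/-- Controlled-NOT with control qubit `i` and target qubit `j` (no effect if `i = j`). -/
def gateCNOT (i j : ℕ) (ψ : QState) : QState := fun s =>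
  if i ≠ j ∧ i ∈ s then ψ (symmDiff s {j}) else ψ s

open Classical in
/-- Projection on the outcome `b` of a computational basis measurement of qubit `i`. -/
def project (i : ℕ) (b : Bool) (ψ : QState) : QState := fun s =>
  if (i ∈ s ↔ b = true) then ψ s else 0

/-- A single-qubit state `q 0 |0⟩ + q 1 |1⟩`. -/
abbrev Qubit : Type := Fin 2 → ℂ

/-- The state `|0⟩`. -/
def ket0 : Qubit := ![1, 0]

/-- The state `|+_θ⟩ = (|0⟩ + e^{iθ}|1⟩)/√2`. -/
def ketPlus (θ : ℝ) : Qubit :=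
  ![1 / (Real.sqrt 2 : ℂ), Complex.exp (Complex.I * θ) / (Real.sqrt 2 : ℂ)]

/-- The register whose qubit `0` is in state `q` and whose other qubits are all `|0⟩`. -/
def QState.ofQubit (q : Qubit) : QState := fun s =>
  if s = ∅ then q 0 else if s = {0} then q 1 else 0

/-! ### Quantum polynomial time

A classically controlled quantum machine: a finite program which works on stacks of classical bits
and, through two movable heads, on an unbounded register of qubits, to which it applies
the universal gate set `H`, `T`, `CNOT` and computational basis measurements. -/

/-- Instructions of a program with set of labels `Λ`. -/
inductive Instr (Λ : Type) : Type
  /-- push bit `b` on classical stack `i` -/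
  | push (i : ℕ) (b : Bool) (next : Λ)
  /-- pop classical stack `i` and branch on the bit found there (or on the stack being empty) -/
  | pop (i : ℕ) (ifEmpty ifZero ifOne : Λ)
  /-- move head `h` to the next qubit -/
  | right (h : Fin 2) (next : Λ)
  /-- move head `h` to the previous qubit (it stays where it is on qubit `0`) -/
  | left (h : Fin 2) (next : Λ)
  /-- Hadamard gate on the qubit under head `h` -/
  | hadamard (h : Fin 2) (next : Λ)
  /-- `T` gate on the qubit under head `h` -/
  | tgate (h : Fin 2) (next : Λ)
  /-- controlled-NOT, the control under head `0` and the target under head `1` -/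
  | cnot (next : Λ)
  /-- measure the qubit under head `h` and branch on the outcome -/
  | measure (h : Fin 2) (ifZero ifOne : Λ)
  /-- halt; the output is the content of classical stack `0` -/
  | halt

/-- A machine: a finite program with a start label. -/
structure Machine where
  /-- labels of the program -/
  Λ : Type
  [finite_labels : Finite Λ]
  /-- start label -/
  start : Λ
  /-- the instruction at each label -/
  prog : Λ → Instr Λ

/-- The classical part of a configuration. -/
structure Config (Λ : Type) where
  /-- current label -/
  label : Λ
  /-- contents of the classical stacks (top first) -/
  stack : ℕ → List Bool
  /-- positions of the two heads -/
  head : Fin 2 → ℕ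

open Classical in
/-- `M.outProb w t c ψ` is the probability that `M`, started in classical configuration `c` with the
(unnormalised) quantum state `ψ`, halts within `t` steps with output `w`. A measurement splits the
run in two branches, in each of which the state is the unnormalised post-measurement state, so that
the squared norm of the state is the probability of the branch. -/
def Machine.outProb (M : Machine) (w : List Bool) : ℕ → Config M.Λ → QState → ℝ≥0∞
  | 0, c, ψ =>
    match M.prog c.label with
    | .halt => if c.stack 0 = w then normSq ψ else 0
    | _ => 0
  | t + 1, c, ψ =>
    match M.prog c.label with
    | .push i b l =>
        M.outProb w t { c with label := l, stack := Function.update c.stack i (b :: c.stack i) } ψ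
    | .pop i lEmpty lZero lOne =>
        match c.stack i with
        | [] => M.outProb w t { c with label := lEmpty } ψ
        | b :: rest =>
            M.outProb w t
              { c with
                label := if b = true then lOne else lZero
                stack := Function.update c.stack i rest } ψ
    | .right h l =>
        M.outProb w t { c with label := l, head := Function.update c.head h (c.head h + 1) } ψ
    | .left h l =>
        M.outProb w t { c with label := l, head := Function.update c.head h (c.head h - 1) } ψ
    | .hadamard h l => M.outProb w t { c with label := l } (gateH (c.head h) ψ)
    | .tgate h l => M.outProb w t { c with label := l } (gateT (c.head h) ψ)
    | .cnot l => M.outProb w t { c with label := l } (gateCNOT (c.head 0) (c.head 1) ψ)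
    | .measure h lZero lOne =>
        M.outProb w t { c with label := lZero } (project (c.head h) false ψ) +
          M.outProb w t { c with label := lOne } (project (c.head h) true ψ)
    | .halt => if c.stack 0 = w then normSq ψ else 0

/-- A quantum polynomial-time (QPT) algorithm: a machine with a polynomial bound on its running
time, as a function of the security parameter. -/
structure QPT where
  /-- the program -/
  machine : Machine
  /-- the bound on the number of steps -/
  time : Polynomial ℕ

/-- The probability that the algorithm outputs `w` on security parameter `n`, classical input
strings `input` and input qubit `q`. Stack `0` (output) starts empty, stack `1` holds `1^n`, the
following stacks hold the input strings, and both heads start on qubit `0`, which holds `q`. -/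
def QPT.outProb (A : QPT) (n : ℕ) (input : List (List Bool)) (q : Qubit) (w : List Bool) : ℝ≥0∞ :=
  A.machine.outProb w (A.time.eval n)
    { label := A.machine.start
      stack := fun i => ([] :: List.replicate n true :: input).getD i []
      head := fun _ => 0 }
    (QState.ofQubit q)

/-! ### Probabilities -/

/-- A negligible function of the security parameter. -/
def Negligible (ε : ℕ → ℝ) : Prop :=
  Asymptotics.SuperpolynomialDecay Filter.atTop (fun n : ℕ => (n : ℝ)) ε

/-- Expectation of `q` under `P`: if `q a` is the probability of an event given `a`, then this is
the probability of the event when `a` is drawn from `P`. -/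
def expect {α : Type} (P : PMF α) (q : α → ℝ≥0∞) : ℝ≥0∞ := ∑' a, P a * q a

/-- Expectation of `q` under `P` conditioned on `S` (zero if `S` has probability zero). -/
def condExpect {α : Type} (P : PMF α) (S : Set α) (q : α → ℝ≥0∞) : ℝ≥0∞ :=
  expect P (S.indicator q) / expect P (S.indicator 1)

open Classical in
/-- `P` conditioned on `S` (and `P` itself if `S` has probability zero). -/
def condition {α : Type} (P : PMF α) (S : Set α) : PMF α :=
  if h : ∃ a ∈ S, a ∈ P.support then P.filter S h else P

/-! ### Ideal functionalities -/

/-- The classical message lists `(m_C, m_S)` of client and server. -/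
abbrev Messages : Type := List (List Bool) × List (List Bool)

/-- Outcome of a protocol: `none` if it returns `abort` to both parties; otherwise the client
receives `(m_C, r)`, where `r` describes the angle `θ = r π/4`, and the server receives `m_S`
together with a qubit. -/
abbrev Outcome : Type :=
  Option ((List (List Bool) × Fin 8) × (List (List Bool) × Qubit))

/-- What the server receives: `abort`, or a list of classical messages and a qubit. -/
abbrev View : Type := Option (List (List Bool) × Qubit)

/-- The server's part of the outcome. -/
def serverView (P : PMF Outcome) : PMF View := P.map (Option.map Prod.snd)

/-- The distribution on `Bool` that gives `true` with probability `p`. -/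
def coin (p : ℝ≥0∞) (hp : p ≤ 1) : PMF Bool :=
  PMF.ofFintype (fun b => if b = true then p else 1 - p) (by simp [hp])

/-- The Secret Random Qubit Generator `𝓕(M, p)`. -/
def SRQG (M : PMF Messages) (p : ℝ≥0∞) (hp : p ≤ 1) : PMF Outcome :=
  (coin p hp).bind fun abort =>
    if abort = true then PMF.pure none
    else M.bind fun m => (PMF.uniformOfFintype (Fin 8)).bind fun r =>
      PMF.pure (some ((m.1, r), (m.2, ketPlus (r.val * (Real.pi / 4)))))

/-- The probability that `A` outputs `1` on a view of the server. The first input string is a flag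
which tells whether the protocol aborted. -/
def QPT.acceptView (A : QPT) (n : ℕ) : View → ℝ≥0∞
  | none => A.outProb n [[true]] ket0 [true]
  | some (m, q) => A.outProb n ([false] :: m) q [true]

/-- `P` is a PSRQG, witnessed by the functionalities `𝓕(M n, p n)`: no QPT adversary distinguishes
the server's view in `P` from its view in `𝓕(M, p)` with more than negligible advantage. -/
def IsPSRQGWith (P : ℕ → PMF Outcome) (M : ℕ → PMF Messages) (p : ℕ → ℝ≥0∞) : Prop :=
  ∃ hp : ∀ n, p n ≤ 1, ∀ A : QPT, Negligible fun n =>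
    |(expect (serverView (P n)) (A.acceptView n)).toReal -
      (expect (serverView (SRQG (M n) (p n) (hp n))) (A.acceptView n)).toReal|

/-! ### Two-regular function families and the Ideal QFactory protocol -/

/-- A family of two-regular functions `f_k : D → R ⊆ {0,1}^*`, `k ∈ K`, with a generator of pairs
(index, trapdoor); all of it depends on the security parameter, and everything is encoded by
bit strings. `E` is the set from which the additional parameter `β` is drawn. -/
structure TwoRegularFamily where
  K : ℕ → Set (List Bool)
  D : ℕ → Finset (List Bool)
  E : ℕ → Finset (List Bool)
  Gen : (n : ℕ) → PMF (K n × List Bool)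
  f : (n : ℕ) → K n → D n → List Bool
  D_nonempty : ∀ n, Nonempty (D n)
  E_nonempty : ∀ n, Nonempty (E n)
  two_regular : ∀ n (k : K n), ∀ y ∈ Set.range (f n k), {x | f n k x = y}.ncard = 2

namespace TwoRegularFamily

variable (F : TwoRegularFamily)

instance (n : ℕ) : Nonempty (F.D n) := F.D_nonempty n
instance (n : ℕ) : Nonempty (F.E n) := F.E_nonempty n

theorem exists_other (n : ℕ) (k : F.K n) (x : F.D n) : ∃ x', x' ≠ x ∧ F.f n k x' = F.f n k x := by
  have h := F.two_regular n k (F.f n k x) ⟨x, rfl⟩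
  obtain ⟨a, b, hab, hs⟩ := Set.ncard_eq_two.1 h
  have ha : F.f n k a = F.f n k x := by
    have : a ∈ {z | F.f n k z = F.f n k x} := by rw [hs]; simp
    exact this
  have hb : F.f n k b = F.f n k x := by
    have : b ∈ {z | F.f n k z = F.f n k x} := by rw [hs]; simp
    exact this
  by_cases hax : a = x
  · exact ⟨b, fun hbx => hab (hax.trans hbx.symm), hb⟩
  · exact ⟨a, hax, ha⟩

/-- The unique preimage `x' ≠ x` of `f_k(x)`. -/
def other (n : ℕ) (k : F.K n) (x : F.D n) : F.D n := (F.exists_other n k x).choose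

/-- The functions `g_k : D × D × E → {0,1}³`, with three-bit strings read as numbers in binary. -/
abbrev PhaseFamily : Type := (n : ℕ) → F.K n → F.D n → F.D n → F.E n → Fin 8

/-- The pair of `x` and the other preimage of `f_k(x)` makes the protocol go on: the last bits
differ. -/
def NoAbort (n : ℕ) (k : F.K n) (x : F.D n) : Prop :=
  (x : List Bool).getLast? ≠ (F.other n k x : List Bool).getLast?

/-- The trusted party's random choices: index, trapdoor, `x` and `β`. -/
structure Run (n : ℕ) where
  k : F.K n
  t : List Bool
  x : F.D n
  β : F.E n

/-- `(k, t_k) ← Gen(1^n)`, `x ← D` and `β ← E`. -/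
def runDist (n : ℕ) : PMF (F.Run n) :=
  (F.Gen n).bind fun kt => (PMF.uniformOfFintype (F.D n)).bind fun x =>
    (PMF.uniformOfFintype (F.E n)).bind fun β => PMF.pure ⟨kt.1, kt.2, x, β⟩

open Classical in
/-- The outcome of the Ideal QFactory protocol for given random choices. -/
def qfactoryOutcome (g : F.PhaseFamily) (n : ℕ) (s : F.Run n) : Outcome :=
  if F.NoAbort n s.k s.x then
    let y := F.f n s.k s.x
    let B := g n s.k s.x (F.other n s.k s.x) s.β
    some (([s.t, y, s.β], B), ([s.k, y, s.β], ketPlus (B.val * (Real.pi / 4))))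
  else none

/-- The Ideal QFactory protocol. -/
def qfactory (g : F.PhaseFamily) (n : ℕ) : PMF Outcome :=
  (F.runDist n).map (F.qfactoryOutcome g n)

/-- The probability that the Ideal QFactory protocol aborts. -/
def abortProb (n : ℕ) : ℝ≥0∞ :=
  expect (F.runDist n) ({s | ¬ F.NoAbort n s.k s.x}.indicator 1)

/-- The elements of `R` with two preimages under `f_k`. -/
def twoPreimages (n : ℕ) (k : F.K n) : Set (List Bool) := {y | {x | F.f n k x = y}.ncard = 2}

theorem twoPreimages_finite (n : ℕ) (k : F.K n) : (F.twoPreimages n k).Finite := by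
  refine (Set.finite_range (F.f n k)).subset fun y hy => ?_
  obtain ⟨x, hx⟩ : {x | F.f n k x = y}.Nonempty :=
    Set.nonempty_of_ncard_ne_zero (by rw [show _ = 2 from hy]; norm_num)
  exact ⟨x, hx⟩

theorem twoPreimages_nonempty (n : ℕ) (k : F.K n) :
    (F.twoPreimages_finite n k).toFinset.Nonempty := by
  obtain ⟨x⟩ := F.D_nonempty n
  exact ⟨F.f n k x, (Set.Finite.mem_toFinset _).2 (F.two_regular n k _ ⟨x, rfl⟩)⟩

/-- The choices behind a sample of `M_QF`. -/
structure Sample (n : ℕ) where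
  k : F.K n
  t : List Bool
  y : List Bool
  β : F.E n

/-- `(k, t_k) ← Gen(1^n)`, `y` uniform among the elements with two preimages, and `β ← E`. -/
def sampleDist (n : ℕ) : PMF (F.Sample n) :=
  (F.Gen n).bind fun kt =>
    (PMF.uniformOfFinset (F.twoPreimages_finite n kt.1).toFinset
      (F.twoPreimages_nonempty n kt.1)).bind fun y =>
    (PMF.uniformOfFintype (F.E n)).bind fun β => PMF.pure ⟨kt.1, kt.2, y, β⟩

/-- The message lists `((t_k, y, β), (k, y, β))`. -/
def Sample.messages {F : TwoRegularFamily} {n : ℕ} (s : F.Sample n) : Messages :=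
  ([s.t, s.y, s.β], [s.k, s.y, s.β])

/-- The distribution `M_QF`. -/
def MQF (n : ℕ) : PMF Messages := (F.sampleDist n).map Sample.messages

/-- The distribution `M_QF` conditioned on the last bits of the two preimages of `y` being
different. -/
def MQFNoAbort (n : ℕ) : PMF Messages :=
  (condition (F.sampleDist n) {s | ∀ x, F.f n s.k x = s.y → F.NoAbort n s.k x}).map
    Sample.messages

/-- The three-bit string of a number below eight, most significant bit first. -/
def bits (v : Fin 8) : List Bool := [v.val.testBit 2, v.val.testBit 1, v.val.testBit 0]

/-- `g_k(x, x', β)`, restricted to the pairs of distinct `x`, `x'` with `f_k(x) = f_k(x')` such that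
`S` holds, is a (quantum-safe) hard-core function for `f_k`: it can be computed in quantum
polynomial time from `k, x, x', β`, and no QPT algorithm that is given `k`, `y = f_k(x)` and `β`
distinguishes it from a uniform element of `{0,1}³` with more than negligible advantage, where
`k ← Gen(1^n)`, `x ← D`, `β ← E` (conditioned on `S`). -/
def HardCore (g : F.PhaseFamily) (S : (n : ℕ) → F.K n → F.D n → Prop) : Prop :=
  (∃ C : QPT, ∀ n (k : F.K n) (x : F.D n) (β : F.E n), S n k x →
    2 / 3 ≤ C.outProb n [k, x, F.other n k x, β] ket0 (bits (g n k x (F.other n k x) β))) ∧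
  ∀ A : QPT, Negligible fun n =>
    |(condExpect (F.runDist n) {s | S n s.k s.x} fun s =>
        A.outProb n [bits (g n s.k s.x (F.other n s.k s.x) s.β), s.k, F.f n s.k s.x, s.β]
          ket0 [true]).toReal -
      (condExpect (F.runDist n) {s | S n s.k s.x} fun s =>
        expect (PMF.uniformOfFintype (Fin 8)) fun r =>
          A.outProb n [bits r, s.k, F.f n s.k s.x, s.β] ket0 [true]).toReal|

end TwoRegularFamily

end QFactory

end

namespace QFactory

/-! ### Norms of states and bounds on output probabilities -/

/-! The proof is a reduction. The state `|+_{rπ/4}⟩` can be prepared from the three bits of `r`, so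
an adversary `A` on the server's view becomes an adversary `A.withPlus` of the same power in the
classical hard-core game: it prepares the qubit and then runs `A` (`QPT.withPlus_outProb`). Applied
to `A.withPlus`, the hard-core property says that `A` hardly distinguishes the real qubit from a
uniformly random one, given `k, y, β` (`HardCore.negligible`).

The classical messages agree because all fibres have size two: `f_k` of a uniform `x` is uniform on
the image, and whether the run aborts depends only on `y` (`map_runDist`, `preimage_toSample`).

It remains to account for aborts. In the second claim the abort terms of the two worlds cancel, and
the rest differs by `1 - p` times the conditional advantage. In the first claim the hard-core game
also includes aborting runs, which costs at most an additional `p`. Norm preservation keeps all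
acceptance probabilities at most one, which these estimates need. -/

theorem symmDiff_singleton_involutive (i : ℕ) :
    Function.Involutive fun s : Finset ℕ => symmDiff s {i} := fun s => by
  simp

theorem tsum_symmDiff_singleton (i : ℕ) (φ : Finset ℕ → ℝ≥0∞) :
    ∑' s, φ (symmDiff s {i}) = ∑' s, φ s :=
  (symmDiff_singleton_involutive i).toPerm.tsum_eq φ

theorem enorm_sq_hadamard (a b : ℂ) :
    ‖(a + b) / (Real.sqrt 2 : ℂ)‖ₑ ^ 2 + ‖(a - b) / (Real.sqrt 2 : ℂ)‖ₑ ^ 2 =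
      ‖a‖ₑ ^ 2 + ‖b‖ₑ ^ 2 := by
  have h : ∀ z : ℂ, ‖z‖ₑ ^ 2 = ENNReal.ofReal (‖z‖ ^ 2) := fun z => by
    rw [ENNReal.ofReal_pow (norm_nonneg _), ofReal_norm]
  simp only [h]
  rw [← ENNReal.ofReal_add (by positivity) (by positivity),
    ← ENNReal.ofReal_add (by positivity) (by positivity)]
  congr 1
  have h2 : ‖(Real.sqrt 2 : ℂ)‖ ^ 2 = 2 := by
    rw [Complex.norm_real, Real.norm_eq_abs, sq_abs, Real.sq_sqrt (by norm_num)]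
  simp only [norm_div, div_pow, h2]
  have := parallelogram_law_with_norm ℝ a b
  nlinarith

/-- Doubling the sum lets each `s` be grouped with `symmDiff s {i}`; on such a pair the gate is a
2×2 Hadamard matrix, and the parallelogram law applies. -/
theorem normSq_gateH (i : ℕ) (ψ : QState) : normSq (gateH i ψ) = normSq ψ := by
  have key : 2 * normSq (gateH i ψ) = 2 * normSq ψ := by
    have hsum : ∀ φ : QState, 2 * normSq φ =
        ∑' s, (‖φ s‖ₑ ^ 2 + ‖φ (symmDiff s {i})‖ₑ ^ 2) := fun φ => by
      rw [ENNReal.tsum_add, tsum_symmDiff_singleton i fun s => ‖φ s‖ₑ ^ 2, two_mul]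
      rfl
    rw [hsum, hsum]
    refine tsum_congr fun s => ?_
    by_cases hi : i ∈ s
    · have h1 : symmDiff s {i} = s.erase i := by
        ext j; by_cases hj : j = i <;> simp [Finset.mem_symmDiff, hj, hi]
      rw [h1, add_comm, add_comm (‖ψ s‖ₑ ^ 2)]
      simpa [gateH, hi] using enorm_sq_hadamard (ψ (s.erase i)) (ψ s)
    · have h1 : symmDiff s {i} = insert i s := by
        ext j; by_cases hj : j = i <;> simp [Finset.mem_symmDiff, hj, hi]
      rw [h1]
      simpa [gateH, hi] using enorm_sq_hadamard (ψ s) (ψ (insert i s))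
  exact (ENNReal.mul_right_inj two_ne_zero ENNReal.ofNat_ne_top).1 key

theorem normSq_gateT (i : ℕ) (ψ : QState) : normSq (gateT i ψ) = normSq ψ := by
  refine tsum_congr fun s => ?_
  unfold gateT
  split_ifs
  · have h : ‖Complex.exp (Complex.I * (Real.pi / 4 : ℝ))‖ₑ = 1 := by
      rw [← ofReal_norm, mul_comm, Complex.norm_exp_ofReal_mul_I, ENNReal.ofReal_one]
    rw [enorm_mul, h, one_mul]
  · rfl

/-- For `i ≠ j` the control bit survives the flip of the target, so the gate permutes the basis by
an involution. -/
theorem normSq_gateCNOT (i j : ℕ) (ψ : QState) : normSq (gateCNOT i j ψ) = normSq ψ := by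
  by_cases hij : i = j
  · simp [normSq, gateCNOT, hij]
  · have hinv : Function.Involutive fun s : Finset ℕ => if i ∈ s then symmDiff s {j} else s := by
      intro s
      by_cases hi : i ∈ s
      · have : i ∈ symmDiff s {j} := by simp [Finset.mem_symmDiff, hi, hij]
        simp only [hi, this, if_true]
        exact symmDiff_singleton_involutive j s
      · simp [hi]
    refine Eq.trans (tsum_congr fun s => ?_) (hinv.toPerm.tsum_eq fun s => ‖ψ s‖ₑ ^ 2)
    by_cases hi : i ∈ s <;> simp [gateCNOT, hij, hi]

theorem normSq_project_add (i : ℕ) (ψ : QState) :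
    normSq (project i false ψ) + normSq (project i true ψ) = normSq ψ := by
  unfold normSq
  rw [← ENNReal.tsum_add]
  refine tsum_congr fun s => ?_
  by_cases hi : i ∈ s <;> simp [project, hi]

theorem Machine.outProb_le_normSq (M : Machine) (w : List Bool) (t : ℕ) (c : Config M.Λ)
    (ψ : QState) : M.outProb w t c ψ ≤ normSq ψ := by
  induction t generalizing c ψ with
  | zero =>
    unfold Machine.outProb
    split
    · split_ifs <;> simp
    · simp
  | succ t ih =>
    unfold Machine.outProb
    split
    · exact ih _ _
    · split <;> exact ih _ _
    · exact ih _ _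
    · exact ih _ _
    · exact (ih _ _).trans (normSq_gateH _ _).le
    · exact (ih _ _).trans (normSq_gateT _ _).le
    · exact (ih _ _).trans (normSq_gateCNOT _ _ _).le
    · exact (add_le_add (ih _ _) (ih _ _)).trans (normSq_project_add _ _).le
    · split_ifs <;> simp

theorem normSq_ofQubit (q : Qubit) : normSq (QState.ofQubit q) = ‖q 0‖ₑ ^ 2 + ‖q 1‖ₑ ^ 2 := by
  have hne : (∅ : Finset ℕ) ≠ {0} := (Finset.singleton_ne_empty 0).symm
  unfold normSq
  rw [tsum_eq_sum (s := {∅, {0}}), Finset.sum_pair hne]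
  · simp [QState.ofQubit]
  · intro s hs
    simp only [Finset.mem_insert, Finset.mem_singleton, not_or] at hs
    simp [QState.ofQubit, hs.1, hs.2]

theorem normSq_ofQubit_ket0 : normSq (QState.ofQubit ket0) = 1 := by
  simp [normSq_ofQubit, ket0]

theorem normSq_ofQubit_ketPlus (θ : ℝ) : normSq (QState.ofQubit (ketPlus θ)) = 1 := by
  have h : ‖Complex.exp (Complex.I * θ)‖ₑ = ‖(1 : ℂ)‖ₑ := by
    rw [← ofReal_norm, mul_comm, Complex.norm_exp_ofReal_mul_I]
    simp
  -- With second entry `0` both terms are the squared modulus of `1/√2`, so this is the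
  -- normalisation needed.
  have h2 := enorm_sq_hadamard 1 0
  simp only [add_zero, sub_zero] at h2
  rw [normSq_ofQubit]
  simp only [ketPlus, Matrix.cons_val_zero, Matrix.cons_val_one, div_eq_mul_inv, enorm_mul, h]
    at h2 ⊢
  rw [h2]
  simp

theorem QPT.outProb_le_one (A : QPT) (n : ℕ) (input : List (List Bool)) {q : Qubit}
    (hq : normSq (QState.ofQubit q) = 1) (w : List Bool) : A.outProb n input q w ≤ 1 :=
  (A.machine.outProb_le_normSq _ _ _ _).trans hq.le

/-! ### Preparing `|+_θ⟩` from the binary expansion of the angle -/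

theorem gateH_ofQubit (q : Qubit) : gateH 0 (QState.ofQubit q) =
    QState.ofQubit ![(q 0 + q 1) / (Real.sqrt 2 : ℂ), (q 0 - q 1) / (Real.sqrt 2 : ℂ)] := by
  funext s
  by_cases h0 : (0 : ℕ) ∈ s
  · have hs : s ≠ ∅ := fun h => by simp [h] at h0
    by_cases h1 : s = {0}
    · subst h1
      simp [gateH, QState.ofQubit]
    · have h2 : s.erase 0 ≠ ∅ := fun h => by
        rcases (Finset.erase_eq_empty_iff s 0).1 h with h | h
        exacts [hs h, h1 h]
      have h3 : s.erase 0 ≠ {0} := fun h => by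
        have : (0 : ℕ) ∈ s.erase 0 := by rw [h]; simp
        simp at this
      simp [gateH, QState.ofQubit, h0, hs, h1, h2, h3]
  · have h1 : s ≠ {0} := fun h => by simp [h] at h0
    by_cases hs : s = ∅
    · subst hs
      simp [gateH, QState.ofQubit]
    · have h3 : insert 0 s ≠ {0} := fun h => by
        obtain ⟨j, hj⟩ := Finset.nonempty_iff_ne_empty.2 hs
        have : j ∈ insert 0 s := by simp [hj]
        rw [h, Finset.mem_singleton] at this
        exact h0 (this ▸ hj)
      simp [gateH, QState.ofQubit, h0, hs, h1, h3]

theorem gateT_ofQubit (q : Qubit) : gateT 0 (QState.ofQubit q) =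
    QState.ofQubit ![q 0, Complex.exp (Complex.I * (Real.pi / 4 : ℝ)) * q 1] := by
  funext s
  by_cases hs : s = ∅
  · simp [gateT, QState.ofQubit, hs]
  · by_cases h1 : s = {0}
    · simp [gateT, QState.ofQubit, h1]
    · simp [gateT, QState.ofQubit, hs, h1]

theorem gateCNOT_self (i : ℕ) (ψ : QState) : gateCNOT i i ψ = ψ := by
  funext s
  simp [gateCNOT]

theorem gateH_ket0 : gateH 0 (QState.ofQubit ket0) = QState.ofQubit (ketPlus 0) := by
  rw [gateH_ofQubit]
  congr 1
  simp [ket0, ketPlus]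

theorem gateT_ketPlus (θ : ℝ) : gateT 0 (QState.ofQubit (ketPlus θ)) =
    QState.ofQubit (ketPlus (θ + Real.pi / 4)) := by
  rw [gateT_ofQubit]
  congr 1
  simp only [ketPlus, Matrix.cons_val_zero, Matrix.cons_val_one]
  congr 2
  rw [← mul_div_assoc, ← Complex.exp_add]
  push_cast
  ring_nf

/-- Labels of the part of the program of `Machine.withPlus` that prepares the qubit. -/
inductive PrepLabel : Type
  | first
  | bit2
  | bit1 (b2 : Bool)
  | bit0 (b2 b1 : Bool)
  | rotate (r : Fin 8) (j : Fin 8)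

instance : Finite PrepLabel :=
  Finite.of_surjective
    (fun l : Unit ⊕ Unit ⊕ Bool ⊕ (Bool × Bool) ⊕ (Fin 8 × Fin 8) => match l with
      | .inl _ => PrepLabel.first
      | .inr (.inl _) => .bit2
      | .inr (.inr (.inl b)) => .bit1 b
      | .inr (.inr (.inr (.inl b))) => .bit0 b.1 b.2
      | .inr (.inr (.inr (.inr j))) => .rotate j.1 j.2)
    fun
      | .first => ⟨.inl (), rfl⟩
      | .bit2 => ⟨.inr (.inl ()), rfl⟩
      | .bit1 b => ⟨.inr (.inr (.inl b)), rfl⟩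
      | .bit0 b c => ⟨.inr (.inr (.inr (.inl (b, c)))), rfl⟩
      | .rotate r j => ⟨.inr (.inr (.inr (.inr (r, j)))), rfl⟩

/-- The number below eight with the given binary digits, most significant first. -/
def ofBits (b2 b1 b0 : Bool) : Fin 8 :=
  Fin.ofNat 8 (4 * b2.toNat + 2 * b1.toNat + b0.toNat)

/-- The same instruction in a program in which the labels are renamed. -/
def Instr.mapLabel {Λ Λ' : Type} (e : Λ → Λ') : Instr Λ → Instr Λ'
  | .push i b l => .push i b (e l)
  | .pop i l l0 l1 => .pop i (e l) (e l0) (e l1)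
  | .right h l => .right h (e l)
  | .left h l => .left h (e l)
  | .hadamard h l => .hadamard h (e l)
  | .tgate h l => .tgate h (e l)
  | .cnot l => .cnot (e l)
  | .measure h l0 l1 => .measure h (e l0) (e l1)
  | .halt => .halt

/-- The machine that replaces the three bits of `r` on stack `2` by the bit `0`, prepares
`|+_{rπ/4}⟩` on qubit `0`, and then runs `M`. The loop applying the `T` gate is padded to length
seven by controlled-NOTs with equal control and target, which do nothing. -/
def Machine.withPlus (M : Machine) : Machine where
  Λ := PrepLabel ⊕ M.Λ
  finite_labels := have := M.finite_labels; inferInstance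
  start := .inl .first
  prog
    | .inl .first => .hadamard 0 (.inl .bit2)
    -- The empty-stack targets here and below are arbitrary: three bits are present in every run of
    -- interest.
    | .inl .bit2 => .pop 2 (.inl .first) (.inl (.bit1 false)) (.inl (.bit1 true))
    | .inl (.bit1 b2) => .pop 2 (.inl .first) (.inl (.bit0 b2 false)) (.inl (.bit0 b2 true))
    | .inl (.bit0 b2 b1) =>
        .pop 2 (.inl .first) (.inl (.rotate (ofBits b2 b1 false) 0))
          (.inl (.rotate (ofBits b2 b1 true) 0))
    | .inl (.rotate r j) =>
        if j = 7 then .push 2 false (.inr M.start)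
        else if j < r then .tgate 0 (.inl (.rotate r (j + 1)))
        else .cnot (.inl (.rotate r (j + 1)))
    | .inr l => (M.prog l).mapLabel .inr

theorem ofBits_testBit (r : Fin 8) :
    ofBits (r.val.testBit 2) (r.val.testBit 1) (r.val.testBit 0) = r := by
  revert r
  decide

theorem Machine.withPlus_outProb_inr (M : Machine) (w : List Bool) (t : ℕ) (l : M.Λ)
    (stack : ℕ → List Bool) (head : Fin 2 → ℕ) (ψ : QState) :
    M.withPlus.outProb w t ⟨.inr l, stack, head⟩ ψ = M.outProb w t ⟨l, stack, head⟩ ψ := by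
  induction t generalizing l stack head ψ with
  | zero =>
    have h : M.withPlus.prog (.inr l) = (M.prog l).mapLabel .inr := rfl
    unfold Machine.outProb
    simp only [h]
    cases M.prog l <;> rfl
  | succ t ih =>
    have h : M.withPlus.prog (.inr l) = (M.prog l).mapLabel .inr := rfl
    unfold Machine.outProb
    simp only [h]
    cases M.prog l with
    | pop i l l0 l1 =>
      simp only [Instr.mapLabel]
      cases stack i with
      | nil => exact ih _ _ _ _
      | cons b rest => cases b <;> exact ih _ _ _ _
    | measure h l0 l1 => exact congrArg₂ (· + ·) (ih _ _ _ _) (ih _ _ _ _)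
    | halt => rfl
    | _ => exact ih _ _ _ _

/-- Loop invariant: with `m` passes left the counter is `7 - m`, and `min r (7 - m)` `T` gates have
been applied. The extra step is the final push of the bit `0`. -/
theorem Machine.withPlus_outProb_rotate (M : Machine) (w : List Bool) (t : ℕ) (r : Fin 8)
    (m : ℕ) (hm : m ≤ 7) (stack : ℕ → List Bool) :
    M.withPlus.outProb w (t + 1 + m)
        ⟨.inl (.rotate r (Fin.ofNat 8 (7 - m))), stack, fun _ => 0⟩
        (QState.ofQubit (ketPlus ((min r.val (7 - m) : ℕ) * (Real.pi / 4)))) =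
      M.outProb w t ⟨M.start, Function.update stack 2 (false :: stack 2), fun _ => 0⟩
        (QState.ofQubit (ketPlus (r.val * (Real.pi / 4)))) := by
  induction m with
  | zero =>
    have hr : min r.val (7 - 0) = r.val := by omega
    rw [hr]
    exact M.withPlus_outProb_inr w t _ _ _ _
  | succ m ih =>
    rw [← ih (by omega)]
    have hj : Fin.ofNat 8 (7 - (m + 1)) ≠ 7 := by
      simp only [ne_eq, Fin.ext_iff, Fin.ofNat]
      change ¬ (7 - (m + 1)) % 8 = 7
      omega
    have hj' : (Fin.ofNat 8 (7 - (m + 1)) + 1 : Fin 8) = Fin.ofNat 8 (7 - m) := by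
      simp only [Fin.ext_iff, Fin.ofNat, Fin.val_add]
      change ((7 - (m + 1)) % 8 + 1) % 8 = (7 - m) % 8
      omega
    have hlt : Fin.ofNat 8 (7 - (m + 1)) < r ↔ 7 - (m + 1) < r.val := by
      simp only [Fin.lt_def, Fin.ofNat]
      rw [Nat.mod_eq_of_lt (by omega)]
    rw [← add_assoc, Machine.outProb]
    by_cases hlt' : 7 - (m + 1) < r.val
    · have h : M.withPlus.prog (.inl (.rotate r (Fin.ofNat 8 (7 - (m + 1))))) =
          .tgate 0 (.inl (.rotate r (Fin.ofNat 8 (7 - m)))) := by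
        simp only [Machine.withPlus, if_neg hj, if_pos (hlt.2 hlt'), hj']
      have hmin : min r.val (7 - m) = min r.val (7 - (m + 1)) + 1 := by omega
      simp only [h, gateT_ketPlus, hmin]
      congr 3
      push_cast
      ring
    · have h : M.withPlus.prog (.inl (.rotate r (Fin.ofNat 8 (7 - (m + 1))))) =
          .cnot (.inl (.rotate r (Fin.ofNat 8 (7 - m)))) := by
        simp only [Machine.withPlus, if_neg hj, if_neg (mt hlt.1 hlt'), hj']
      have hmin : min r.val (7 - m) = min r.val (7 - (m + 1)) := by omega
      simp only [h, gateCNOT_self, hmin]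

theorem Machine.outProb_pop (M : Machine) (w : List Bool) (t : ℕ) {l l' le lz lo : M.Λ} {i : ℕ}
    {b : Bool} {rest : List Bool} {stack : ℕ → List Bool} (head : Fin 2 → ℕ) (ψ : QState)
    (hl : M.prog l = .pop i le lz lo) (hs : stack i = b :: rest)
    (hl' : (if b = true then lo else lz) = l') :
    M.outProb w (t + 1) ⟨l, stack, head⟩ ψ =
      M.outProb w t ⟨l', Function.update stack i rest, head⟩ ψ := by
  subst hl'
  rw [Machine.outProb]
  simp only [hl, hs]

/-- The algorithm which reads `r` from the first input string and runs `A` with that string replaced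
by `0` and on the qubit `|+_{rπ/4}⟩`. -/
noncomputable def QPT.withPlus (A : QPT) : QPT where
  machine := A.machine.withPlus
  time := A.time + 12

theorem QPT.withPlus_outProb (A : QPT) (n : ℕ) (r : Fin 8) (input : List (List Bool))
    (w : List Bool) :
    A.withPlus.outProb n (TwoRegularFamily.bits r :: input) ket0 w =
      A.outProb n ([false] :: input) (ketPlus (r.val * (Real.pi / 4))) w := by
  -- Read from the right: Hadamard, three pops, seven padded rotations, one push. As this cost does
  -- not depend on `r`, exactly the time bound of `A` is left, and the probabilities are equal.
  have htime : A.withPlus.time.eval n = A.time.eval n + 1 + 7 + 1 + 1 + 1 + 1 := by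
    simp [QPT.withPlus]
  have hrot := A.machine.withPlus_outProb_rotate w (A.time.eval n) r 7 le_rfl
    (Function.update
      (fun i => ([] :: List.replicate n true :: TwoRegularFamily.bits r :: input).getD i []) 2 [])
  simp only [Nat.sub_self, Nat.min_zero, Nat.cast_zero, zero_mul, Function.update_idem,
    Function.update_self] at hrot
  have hstack : Function.update
      (fun i => ([] :: List.replicate n true :: TwoRegularFamily.bits r :: input).getD i []) 2
        [false] =
      fun i => ([] :: List.replicate n true :: [false] :: input).getD i [] := by
    funext i
    match i with
    | 0 | 1 | 2 => rfl
    | i + 3 => simp [Function.update]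
  rw [hstack] at hrot
  unfold QPT.outProb
  have hpad : (Fin.ofNat 8 0 : Fin 8) = 0 := rfl
  rw [htime, ← hrot, hpad, Machine.outProb]
  change A.machine.withPlus.outProb w _ ⟨.inl .bit2, _, _⟩ (gateH 0 (QState.ofQubit ket0)) = _
  rw [gateH_ket0]
  have hr := ofBits_testBit r
  unfold TwoRegularFamily.bits
  generalize r.val.testBit 2 = b2 at hr ⊢
  generalize r.val.testBit 1 = b1 at hr ⊢
  generalize r.val.testBit 0 = b0 at hr ⊢
  subst hr
  refine (A.machine.withPlus.outProb_pop (l' := .inl (.bit1 b2)) w (A.time.eval n + 1 + 7 + 1 + 1)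
    _ _ rfl rfl (by cases b2 <;> rfl)).trans ?_
  refine (A.machine.withPlus.outProb_pop (l' := .inl (.bit0 b2 b1)) w (A.time.eval n + 1 + 7 + 1)
    _ _ rfl (Function.update_self ..) (by cases b1 <;> rfl)).trans ?_
  refine (A.machine.withPlus.outProb_pop (l' := .inl (.rotate (ofBits b2 b1 b0) 0)) w
    (A.time.eval n + 1 + 7) _ _ rfl (Function.update_self ..) (by cases b0 <;> rfl)).trans ?_
  rw [Function.update_idem, Function.update_idem]

/-! ### Expectations -/

section Expect

variable {α β : Type}

theorem expect_bind (P : PMF α) (Q : α → PMF β) (q : β → ℝ≥0∞) :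
    expect (P.bind Q) q = expect P fun a => expect (Q a) q := by
  simp only [expect, PMF.bind_apply, ← ENNReal.tsum_mul_right, ← ENNReal.tsum_mul_left]
  rw [ENNReal.tsum_comm]
  simp only [mul_assoc]

theorem expect_pure (a : α) (q : α → ℝ≥0∞) : expect (PMF.pure a) q = q a := by
  unfold expect
  rw [tsum_eq_single a fun b hb => by simp [hb]]
  simp

theorem expect_map (P : PMF α) (e : α → β) (q : β → ℝ≥0∞) :
    expect (P.map e) q = expect P (q ∘ e) := by
  rw [← PMF.bind_pure_comp, expect_bind]
  simp only [Function.comp_apply, expect_pure]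
  rfl

theorem expect_add (P : PMF α) (q q' : α → ℝ≥0∞) :
    expect P (q + q') = expect P q + expect P q' := by
  simp only [expect, Pi.add_apply, mul_add, ENNReal.tsum_add]

theorem expect_mono (P : PMF α) {q q' : α → ℝ≥0∞} (h : q ≤ q') : expect P q ≤ expect P q' :=
  ENNReal.tsum_le_tsum fun a => by gcongr; exact h a

theorem expect_mul_const (P : PMF α) (q : α → ℝ≥0∞) (c : ℝ≥0∞) :
    expect P (fun a => q a * c) = expect P q * c := by
  simp only [expect, ← mul_assoc, ENNReal.tsum_mul_right]

theorem expect_one (P : PMF α) : expect P 1 = 1 := by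
  simp [expect]

theorem expect_le_one (P : PMF α) {q : α → ℝ≥0∞} (h : ∀ a, q a ≤ 1) : expect P q ≤ 1 :=
  (expect_mono P h).trans (expect_one P).le

theorem expect_indicator_le (P : PMF α) (S : Set α) {q : α → ℝ≥0∞} (h : ∀ a, q a ≤ 1) :
    expect P (S.indicator q) ≤ expect P (S.indicator 1) :=
  expect_mono P fun _ => Set.indicator_le_indicator (h _)

theorem expect_indicator_one_le_one (P : PMF α) (S : Set α) : expect P (S.indicator 1) ≤ 1 :=
  expect_le_one P fun _ => Set.indicator_le_self _ _ _

theorem expect_indicator_add_compl (P : PMF α) (S : Set α) (q : α → ℝ≥0∞) :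
    expect P (S.indicator q) + expect P (Sᶜ.indicator q) = expect P q := by
  rw [← expect_add, Set.indicator_self_add_compl]

theorem expect_indicator_map (P : PMF α) (e : α → β) (S : Set β) (q : β → ℝ≥0∞) :
    expect (P.map e) (S.indicator q) = expect P ((e ⁻¹' S).indicator (q ∘ e)) := by
  rw [expect_map]
  rfl

theorem expect_indicator_eq_zero {P : PMF α} {S : Set α} (h : expect P (S.indicator 1) = 0)
    (q : α → ℝ≥0∞) : expect P (S.indicator q) = 0 := by
  unfold expect at h ⊢
  rw [ENNReal.tsum_eq_zero] at h ⊢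
  intro a
  have := h a
  by_cases ha : a ∈ S <;> simp_all

theorem expect_condition {P : PMF α} {S : Set α} (h : expect P (S.indicator 1) ≠ 0)
    (q : α → ℝ≥0∞) : expect (condition P S) q = condExpect P S q := by
  have hS : ∃ a ∈ S, a ∈ P.support := by
    by_contra! hS
    refine h (ENNReal.tsum_eq_zero.2 fun a => ?_)
    by_cases ha : a ∈ S
    · simp [(PMF.apply_eq_zero_iff P a).2 (hS a ha)]
    · simp [ha]
  have hind : ∀ (q : α → ℝ≥0∞) a, P a * S.indicator q a = S.indicator P a * q a := fun q a => by
    by_cases ha : a ∈ S <;> simp [ha]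
  unfold condition condExpect expect
  rw [dif_pos hS]
  simp only [PMF.filter_apply, hind, Pi.one_apply, mul_one, div_eq_mul_inv,
    ← ENNReal.tsum_mul_right]
  exact tsum_congr fun a => by ring

/-- The product form needs no positivity: if `S` has probability zero, both sides vanish whatever
`condition` returns. -/
theorem expect_indicator_mul_expect_condition (P : PMF α) (S : Set α) (q : α → ℝ≥0∞) :
    expect P (S.indicator 1) * expect (condition P S) q = expect P (S.indicator q) := by
  by_cases h : expect P (S.indicator 1) = 0
  · rw [h, zero_mul, expect_indicator_eq_zero h]
  · rw [expect_condition h]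
    exact ENNReal.mul_div_cancel h
      ((expect_indicator_one_le_one P S).trans_lt ENNReal.one_lt_top).ne

theorem condExpect_of_forall_mem (P : PMF α) {S : Set α} (h : ∀ a, a ∈ S) (q : α → ℝ≥0∞) :
    condExpect P S q = expect P q := by
  rw [Set.eq_univ_of_forall h]
  simp [condExpect, expect_one]

theorem expect_coin (p : ℝ≥0∞) (hp : p ≤ 1) (q : Bool → ℝ≥0∞) :
    expect (coin p hp) q = p * q true + (1 - p) * q false := by
  unfold expect
  rw [tsum_bool, add_comm]
  simp [coin]

end Expect

/-! ### The server's views -/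

theorem Negligible.of_le {ε δ : ℕ → ℝ} (hδ : Negligible δ) (h0 : ∀ n, 0 ≤ ε n)
    (h : ∀ n, ε n ≤ δ n) : Negligible ε :=
  Asymptotics.SuperpolynomialDecay.trans_abs_le hδ fun n => by
    rw [abs_of_nonneg (h0 n)]
    exact (h n).trans (le_abs_self _)

theorem QPT.acceptView_none_le_one (A : QPT) (n : ℕ) : A.acceptView n none ≤ 1 :=
  A.outProb_le_one n _ normSq_ofQubit_ket0 _

theorem QPT.acceptView_ketPlus_le_one (A : QPT) (n : ℕ) (m : List (List Bool)) (θ : ℝ) :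
    A.acceptView n (some (m, ketPlus θ)) ≤ 1 :=
  A.outProb_le_one n _ (normSq_ofQubit_ketPlus θ) _

/-- The probability that `A` accepts the messages `m` and a qubit in a uniformly random state
`|+_{rπ/4}⟩`. -/
noncomputable def QPT.idealAccept (A : QPT) (n : ℕ) (m : List (List Bool)) : ℝ≥0∞ :=
  expect (PMF.uniformOfFintype (Fin 8)) fun r =>
    A.acceptView n (some (m, ketPlus (r.val * (Real.pi / 4))))

theorem QPT.idealAccept_le_one (A : QPT) (n : ℕ) (m : List (List Bool)) :
    A.idealAccept n m ≤ 1 :=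
  expect_le_one _ fun _ => A.acceptView_ketPlus_le_one _ _ _

theorem expect_serverView_SRQG (M : PMF Messages) (p : ℝ≥0∞) (hp : p ≤ 1) (A : QPT) (n : ℕ) :
    expect (serverView (SRQG M p hp)) (A.acceptView n) =
      p * A.acceptView n none + (1 - p) * expect M fun m => A.idealAccept n m.2 := by
  unfold serverView SRQG
  rw [expect_map, expect_bind, expect_coin]
  simp only [if_true, expect_pure, expect_bind, Bool.false_eq_true, if_false]
  rfl

namespace TwoRegularFamily

variable (F : TwoRegularFamily) {n : ℕ}

/-! ### Two-element fibres and the distribution of `y`. -/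

theorem other_ne (k : F.K n) (x : F.D n) : F.other n k x ≠ x :=
  (F.exists_other n k x).choose_spec.1

theorem f_other (k : F.K n) (x : F.D n) : F.f n k (F.other n k x) = F.f n k x :=
  (F.exists_other n k x).choose_spec.2

theorem eq_or_eq_other {k : F.K n} {x z : F.D n} (h : F.f n k z = F.f n k x) :
    z = x ∨ z = F.other n k x := by
  have hcard := F.two_regular n k (F.f n k x) ⟨x, rfl⟩
  have hsub : ({x, F.other n k x} : Set (F.D n)) ⊆ {z | F.f n k z = F.f n k x} := by
    rintro w (rfl | rfl)
    exacts [rfl, F.f_other k x]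
  have heq := Set.eq_of_subset_of_ncard_le hsub
    (by rw [hcard, Set.ncard_pair (F.other_ne k x).symm]) (Set.toFinite _)
  have hz : z ∈ ({x, F.other n k x} : Set (F.D n)) := heq ▸ h
  simpa using hz

theorem other_other (k : F.K n) (x : F.D n) : F.other n k (F.other n k x) = x :=
  ((F.eq_or_eq_other ((F.f_other k _).trans (F.f_other k x))).resolve_right
    (F.other_ne k _))

/-- `other` swaps the two points of a fibre and the condition is symmetric in them, so aborting is a
property of `y`. -/
theorem noAbort_iff_of_f_eq {k : F.K n} {x z : F.D n} (h : F.f n k z = F.f n k x) :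
    F.NoAbort n k z ↔ F.NoAbort n k x := by
  obtain rfl | rfl := F.eq_or_eq_other h
  · rfl
  · unfold NoAbort
    rw [F.other_other, ne_comm]

theorem mem_twoPreimages_iff (k : F.K n) (y : List Bool) :
    y ∈ F.twoPreimages n k ↔ y ∈ Set.range (F.f n k) := by
  refine ⟨fun hy => ?_, F.two_regular n k y⟩
  obtain ⟨x, hx⟩ : {x | F.f n k x = y}.Nonempty :=
    Set.nonempty_of_ncard_ne_zero (by rw [show _ = 2 from hy]; norm_num)
  exact ⟨x, hx⟩

open Classical in
theorem card_fiber (k : F.K n) {y : List Bool} (hy : y ∈ F.twoPreimages n k) :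
    (Finset.univ.filter fun x => F.f n k x = y).card = 2 := by
  rw [← show {x | F.f n k x = y}.ncard = 2 from hy, ← Set.ncard_coe_finset]
  simp

theorem card_domain (k : F.K n) :
    Fintype.card (F.D n) = (F.twoPreimages_finite n k).toFinset.card * 2 := by
  classical
  rw [← Finset.card_univ, Finset.card_eq_sum_card_fiberwise (f := F.f n k)
    (t := (F.twoPreimages_finite n k).toFinset) fun x _ => by
      simpa using (F.mem_twoPreimages_iff k _).2 ⟨x, rfl⟩]
  exact Finset.sum_const_nat fun y hy => F.card_fiber k ((Set.Finite.mem_toFinset _).1 hy)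

/-- The image under `f_k` of a uniform element of the domain is uniform on the image of `f_k`. -/
theorem map_uniformOfFintype (k : F.K n) :
    (PMF.uniformOfFintype (F.D n)).map (F.f n k) =
      PMF.uniformOfFinset (F.twoPreimages_finite n k).toFinset (F.twoPreimages_nonempty n k) := by
  classical
  ext y
  rw [PMF.map_apply, PMF.uniformOfFinset_apply, tsum_fintype]
  simp only [PMF.uniformOfFintype_apply, eq_comm (a := y)]
  rw [← Finset.sum_filter, Finset.sum_const, nsmul_eq_mul]
  split_ifs with hy
  -- The fibre holds two of the `2N` points of the domain, where `N` is the size of the image.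
  · rw [F.card_fiber k ((Set.Finite.mem_toFinset _).1 hy), F.card_domain k]
    push_cast
    rw [ENNReal.mul_inv (Or.inr ENNReal.ofNat_ne_top) (Or.inr two_ne_zero), mul_left_comm,
      ENNReal.mul_inv_cancel two_ne_zero ENNReal.ofNat_ne_top, mul_one]
  · rw [Finset.filter_eq_empty_iff.2 fun x _ hx => hy ?_]
    · simp
    · rw [Set.Finite.mem_toFinset, F.mem_twoPreimages_iff]
      exact ⟨x, hx⟩

/-- The sample of `M_QF` given by the trusted party's random choices. -/
def Run.toSample {F : TwoRegularFamily} (s : F.Run n) : F.Sample n :=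
  ⟨s.k, s.t, F.f n s.k s.x, s.β⟩

theorem map_runDist (n : ℕ) : (F.runDist n).map Run.toSample = F.sampleDist n := by
  unfold runDist sampleDist
  simp only [PMF.map_bind, PMF.pure_map, ← F.map_uniformOfFintype, PMF.bind_map]
  rfl

theorem preimage_toSample (n : ℕ) :
    Run.toSample ⁻¹' {s : F.Sample n | ∀ x, F.f n s.k x = s.y → F.NoAbort n s.k x} =
      {s | F.NoAbort n s.k s.x} := by
  ext s
  exact ⟨fun h => h s.x rfl, fun h x hx => (F.noAbort_iff_of_f_eq hx).2 h⟩

theorem abortProb_le_one (n : ℕ) : F.abortProb n ≤ 1 :=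
  expect_indicator_one_le_one _ _

theorem expect_noAbort (n : ℕ) :
    expect (F.runDist n) ({s | F.NoAbort n s.k s.x}.indicator 1) = 1 - F.abortProb n := by
  refine ENNReal.eq_sub_of_add_eq ((F.abortProb_le_one n).trans_lt ENNReal.one_lt_top).ne ?_
  exact (expect_indicator_add_compl _ {s : F.Run n | F.NoAbort n s.k s.x} 1).trans (expect_one _)

/-! ### Acceptance probabilities in the real and ideal worlds. -/

variable (g : F.PhaseFamily) (A : QPT)

/-- The probability that `A` accepts the server's view of a run that does not abort. -/
noncomputable def realAccept (n : ℕ) (s : F.Run n) : ℝ≥0∞ :=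
  A.acceptView n (some ([s.k, F.f n s.k s.x, s.β],
    ketPlus ((g n s.k s.x (F.other n s.k s.x) s.β).val * (Real.pi / 4))))

theorem expect_serverView_qfactory (n : ℕ) :
    expect (serverView (F.qfactory g n)) (A.acceptView n) =
      expect (F.runDist n) ({s | F.NoAbort n s.k s.x}.indicator (F.realAccept g A n)) +
        F.abortProb n * A.acceptView n none := by
  unfold serverView qfactory abortProb
  rw [PMF.map_comp, expect_map, ← expect_mul_const, ← expect_add]
  congr 1
  funext s
  by_cases h : F.NoAbort n s.k s.x <;> simp [qfactoryOutcome, h, realAccept]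

/-- The reduction: `A.withPlus` plays the hard-core game, and its two acceptance probabilities are
those of `A` on the real and on the random qubit. -/
theorem HardCore.negligible {F : TwoRegularFamily} {g : F.PhaseFamily}
    {S : (n : ℕ) → F.K n → F.D n → Prop} (h : F.HardCore g S) (A : QPT) :
    Negligible fun n =>
      |(condExpect (F.runDist n) {s | S n s.k s.x} (F.realAccept g A n)).toReal -
        (condExpect (F.runDist n) {s | S n s.k s.x} fun s =>
          A.idealAccept n s.toSample.messages.2).toReal| := by
  have := h.2 A.withPlus
  simp only [QPT.withPlus_outProb] at this
  exact this

theorem expect_MQF (n : ℕ) (q : List (List Bool) → ℝ≥0∞) :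
    expect (F.MQF n) (fun m => q m.2) =
      expect (F.runDist n) fun s => q s.toSample.messages.2 := by
  rw [MQF, expect_map, ← F.map_runDist, expect_map]
  rfl

theorem mul_expect_MQFNoAbort (n : ℕ) (q : List (List Bool) → ℝ≥0∞) :
    (1 - F.abortProb n) * expect (F.MQFNoAbort n) (fun m => q m.2) =
      expect (F.runDist n) ({s | F.NoAbort n s.k s.x}.indicator
        fun s => q s.toSample.messages.2) := by
  have h := expect_indicator_mul_expect_condition (F.sampleDist n)
    {s | ∀ x, F.f n s.k x = s.y → F.NoAbort n s.k x} ((fun m => q m.2) ∘ Sample.messages)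
  rw [← F.map_runDist n, expect_indicator_map, expect_indicator_map, preimage_toSample,
    F.map_runDist n] at h
  rw [MQFNoAbort, expect_map, ← expect_noAbort]
  exact h

/-! ### The two security estimates. -/

theorem isPSRQGWith_MQF {F : TwoRegularFamily} {g : F.PhaseFamily}
    (hp : Negligible fun n => (F.abortProb n).toReal) (h : F.HardCore g fun _ _ _ => True) :
    IsPSRQGWith (F.qfactory g) F.MQF F.abortProb := by
  refine ⟨F.abortProb_le_one, fun A => Negligible.of_le
    (Asymptotics.SuperpolynomialDecay.add (h.negligible A) hp) (fun _ => abs_nonneg _) fun n => ?_⟩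
  have hp1 := F.abortProb_le_one n
  have hptop := (hp1.trans_lt ENNReal.one_lt_top).ne
  have hreal : ∀ s, F.realAccept g A n s ≤ 1 := fun s => A.acceptView_ketPlus_le_one _ _ _
  have hideal : expect (F.runDist n) (fun s => A.idealAccept n s.toSample.messages.2) ≤ 1 :=
    expect_le_one _ fun _ => A.idealAccept_le_one _ _
  have hsplit := expect_indicator_add_compl (F.runDist n) {s | F.NoAbort n s.k s.x}
    (F.realAccept g A n)
  have habort : expect (F.runDist n) ({s | F.NoAbort n s.k s.x}ᶜ.indicator (F.realAccept g A n)) ≤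
      F.abortProb n := expect_indicator_le _ _ hreal
  have hone := expect_le_one (F.runDist n) hreal
  rw [expect_serverView_qfactory, expect_serverView_SRQG,
    F.expect_MQF n fun m => A.idealAccept n m]
  simp only [Pi.add_apply, condExpect_of_forall_mem (F.runDist n) (S := {s | True})
    (fun _ => trivial)]
  rw [← hsplit] at hone ⊢
  have hc := A.acceptView_none_le_one n
  -- From here on, `b` is the ideal acceptance probability, `a` and `d` are the parts of the real
  -- one from non-aborting and aborting `x`, and `c` is the acceptance probability on abort.
  generalize expect (F.runDist n) (fun s => A.idealAccept n s.toSample.messages.2) = b at *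
  generalize expect (F.runDist n) ({s | F.NoAbort n s.k s.x}.indicator (F.realAccept g A n)) = a
    at *
  generalize expect (F.runDist n) ({s | F.NoAbort n s.k s.x}ᶜ.indicator (F.realAccept g A n)) = d
    at *
  generalize F.abortProb n = p at *
  generalize A.acceptView n none = c at *
  lift p to NNReal using hptop
  lift b to NNReal using (hideal.trans_lt ENNReal.one_lt_top).ne
  lift c to NNReal using (hc.trans_lt ENNReal.one_lt_top).ne
  lift a to NNReal using ((le_self_add.trans hone).trans_lt ENNReal.one_lt_top).ne
  lift d to NNReal using (habort.trans_lt ENNReal.coe_lt_top).ne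
  norm_cast at hp1 habort hideal
  rw [← ENNReal.coe_one, ← ENNReal.coe_sub]
  norm_cast
  simp only [ENNReal.coe_toReal]
  push_cast [NNReal.coe_sub hp1]
  have e1 : (d : ℝ) ≤ p := habort
  have e2 : (b : ℝ) ≤ 1 := hideal
  have e3 : (p : ℝ) * b ≤ p := mul_le_of_le_one_right p.2 e2
  have e4 : 0 ≤ (p : ℝ) * b := by positivity
  have e5 : (0 : ℝ) ≤ d := d.2
  -- `a + d - b` is the hard-core advantage over all `x`; the correction is at most `p` because `p *
  -- b` and `d` both lie in `[0, p]`.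
  calc |(a : ℝ) + p * c - (p * c + (1 - p) * b)|
      = |((a : ℝ) + d - b) + ((p : ℝ) * b - d)| := by ring_nf
    _ ≤ |(a : ℝ) + d - b| + |(p : ℝ) * b - d| := abs_add_le _ _
    _ ≤ |(a : ℝ) + d - b| + p := by
      gcongr
      exact abs_le.2 ⟨by linarith, by linarith⟩

theorem isPSRQGWith_MQFNoAbort {F : TwoRegularFamily} {g : F.PhaseFamily}
    (h : F.HardCore g F.NoAbort) : IsPSRQGWith (F.qfactory g) F.MQFNoAbort F.abortProb := by
  refine ⟨F.abortProb_le_one, fun A => (h.negligible A).of_le (fun _ => abs_nonneg _) fun n => ?_⟩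
  have hreal : ∀ s, F.realAccept g A n s ≤ 1 := fun s => A.acceptView_ketPlus_le_one _ _ _
  have ha := expect_indicator_le (F.runDist n) {s | F.NoAbort n s.k s.x} hreal
  have hb := expect_indicator_le (F.runDist n) {s | F.NoAbort n s.k s.x} fun s =>
    A.idealAccept_le_one n s.toSample.messages.2
  have hm := expect_indicator_one_le_one (F.runDist n) {s | F.NoAbort n s.k s.x}
  have hc := A.acceptView_none_le_one n
  have hp := F.abortProb_le_one n
  rw [expect_serverView_qfactory, expect_serverView_SRQG,
    F.mul_expect_MQFNoAbort n fun m => A.idealAccept n m, add_comm]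
  unfold condExpect
  generalize expect (F.runDist n) ({s | F.NoAbort n s.k s.x}.indicator (F.realAccept g A n)) = a
    at *
  generalize expect (F.runDist n) ({s | F.NoAbort n s.k s.x}.indicator
    fun s => A.idealAccept n s.toSample.messages.2) = b at *
  generalize expect (F.runDist n) ({s | F.NoAbort n s.k s.x}.indicator 1) = m at *
  have hpc : F.abortProb n * A.acceptView n none ≠ ∞ :=
    ((mul_le_one' hp hc).trans_lt ENNReal.one_lt_top).ne
  have hmtop := (hm.trans_lt ENNReal.one_lt_top).ne
  -- The common abort term cancels, leaving `|a - b|` to compare with the conditional advantage `|a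
  -- - b| / m`.
  rw [ENNReal.toReal_add hpc (ne_top_of_le_ne_top hmtop ha),
    ENNReal.toReal_add hpc (ne_top_of_le_ne_top hmtop hb), add_sub_add_left_eq_sub,
    ENNReal.toReal_div, ENNReal.toReal_div, ← sub_div, abs_div,
    abs_of_nonneg ENNReal.toReal_nonneg]
  -- If every run aborts, `a` and `b` are zero too; otherwise dividing by `m ≤ 1` only increases the
  -- difference.
  obtain rfl | hm0 := eq_or_ne m 0
  · simp [nonpos_iff_eq_zero.1 ha, nonpos_iff_eq_zero.1 hb]
  · exact le_div_self (abs_nonneg _) (ENNReal.toReal_pos hm0 hmtop)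
      (ENNReal.toReal_le_of_le_ofReal zero_le_one (by simpa using hm))

end TwoRegularFamily

end QFactory

theorem lemma3p1 (F : QFactory.TwoRegularFamily) (g : F.PhaseFamily) :
    ((QFactory.Negligible fun n => (F.abortProb n).toReal) →
      F.HardCore g (fun _ _ _ => True) →
        QFactory.IsPSRQGWith (F.qfactory g) F.MQF F.abortProb) ∧
    (F.HardCore g F.NoAbort →
      QFactory.IsPSRQGWith (F.qfactory g) F.MQFNoAbort F.abortProb) :=
  ⟨QFactory.TwoRegularFamily.isPSRQGWith_MQF, QFactory.TwoRegularFamily.isPSRQGWith_MQFNoAbort⟩
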